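/- Let $X$ be a real normed space and let $F\subseteq X^*$ be a norming subspace, i.e. $x\mapsto\sup\{|f(x)| : f\in F,\ \|f\|\le 1\}$ is a norm on $X$ equivalent to the original one. Let $\sigma(X,F)$ be the topology on $X$ of pointwise convergence on $F$. A norm $|\cdot|$ is rotund if $|x|=|y|=|\tfrac12(x+y)|$ implies $x=y$. A topological space $S$ has a $G_\delta$-diagonal if $\{(s,s):s\in S\}$ is a $G_\delta$-set in $S\times S$; equivalently, if it has a $G_\delta$-diagonal sequence, i.e. a sequence $(\mathcal G_n)_{n\in\mathbb N}$ of open covers of $S$ such that for all $x\ne y$ in $S$ there is $n$ such that $y\notin\bigcup\{U\in\mathcal G_n : x\in U\}$. A set $S\subseteq X$ has a $G_\delta$-diagonal with $\sigma(X,F)$-slices if $(S,\sigma(X,F))$ has a $G_\delta$-diagonal sequence all of whose members are of the form $S\cap\{x : f(x)>a\}$ with $0\ne f\in F$ and $a\in\mathbb R$. Then the following are equivalent: 1. $X$ admits an equivalent $\sigma(X,F)$-lower semicontinuous rotund norm; 2. $X$ admits an equivalent $\sigma(X,F)$-lower semicontinuous norm whose unit sphere has a $G_\delta$-diagonal with $\sigma(X,F)$-slices.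 Moreover, if $X=Y^*$ is the dual of a real normed space $Y$ and $F=Y$ (canonically embedded in $Y^{**}$), then (1) is also equivalent to: 3. $Y^*$ admits an equivalent dual norm (i.e. the dual norm of an equivalent norm on $Y$) whose unit sphere has a $G_\delta$-diagonal for the weak$^*$ topology. -/

import Mathlib

namespace Renorming

universe u v

/-- The topology `σ(X, F)` of pointwise convergence on the set `F ⊆ X*`. -/
abbrev sigma {X : Type u} [NormedAddCommGroup X] [NormedSpace ℝ X]
    (F : Set (StrongDual ℝ X)) : TopologicalSpace X :=
  TopologicalSpace.induced (fun (x : X) (f : F) => (f : StrongDual ℝ X) x)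
    Pi.topologicalSpace

/-- `N` is a norm equivalent to the given norm of `X`. (The lower bound makes the seminorm `N`
a norm.) -/
def IsEquivalentNorm {X : Type u} [NormedAddCommGroup X] [NormedSpace ℝ X]
    (N : Seminorm ℝ X) : Prop :=
  ∃ c C : ℝ, 0 < c ∧ 0 < C ∧ ∀ x : X, c * ‖x‖ ≤ N x ∧ N x ≤ C * ‖x‖

/-- The subspace `F ⊆ X*` is norming: `x ↦ sup {|f x| : f ∈ F, ‖f‖ ≤ 1}` is a norm on `X`
equivalent to the given one. -/
def IsNorming {X : Type u} [NormedAddCommGroup X] [NormedSpace ℝ X]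
    (F : Submodule ℝ (StrongDual ℝ X)) : Prop :=
  ∃ N : Seminorm ℝ X, IsEquivalentNorm N ∧
    ∀ x : X, IsLUB {r : ℝ | ∃ f ∈ F, ‖f‖ ≤ 1 ∧ r = |f x|} (N x)

/-- The norm `N` is `σ(X, F)`-lower semicontinuous. -/
def IsSigmaLsc {X : Type u} [NormedAddCommGroup X] [NormedSpace ℝ X]
    (F : Submodule ℝ (StrongDual ℝ X)) (N : Seminorm ℝ X) : Prop :=
  @LowerSemicontinuous X ℝ (sigma (F : Set (StrongDual ℝ X))) _ (fun x => N x)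

/-- Rotundity (strict convexity) of a norm. -/
def IsRotund {X : Type u} [NormedAddCommGroup X] [NormedSpace ℝ X] (N : Seminorm ℝ X) : Prop :=
  ∀ x y : X, N x = N y → N x = N ((1 / 2 : ℝ) • (x + y)) → x = y

/-- The unit sphere of the norm `N`. -/
def unitSphere {X : Type u} [NormedAddCommGroup X] [NormedSpace ℝ X] (N : Seminorm ℝ X) : Set X :=
  {x | N x = 1}

/-- `T` has a G_δ-diagonal: the diagonal is a G_δ-set in `T × T`. -/
def HasGdeltaDiagonal (T : Type u) [TopologicalSpace T] : Prop :=
  IsGδ (Set.diagonal T)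

/-- `G` is a G_δ-diagonal sequence for `T`: a sequence of open covers such that for `x ≠ y` there
is `n` with `y` outside the star `⋃ {U ∈ G n | x ∈ U}`. -/
def IsGdeltaDiagonalSeq {T : Type u} [TopologicalSpace T] (G : ℕ → Set (Set T)) : Prop :=
  (∀ n, ∀ U ∈ G n, IsOpen U) ∧ (∀ n, ⋃₀ G n = Set.univ) ∧
    ∀ x y : T, x ≠ y → ∃ n, y ∉ ⋃₀ {U ∈ G n | x ∈ U}

/-- The two descriptions of spaces with a G_δ-diagonal agree. -/
theorem hasGdeltaDiagonal_iff (T : Type u) [TopologicalSpace T] :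
    HasGdeltaDiagonal T ↔ ∃ G : ℕ → Set (Set T), IsGdeltaDiagonalSeq G := by
  constructor
  · intro h
    obtain ⟨V, hVo, hV⟩ := isGδ_iff_eq_iInter_nat.1 h
    refine ⟨fun n => {U | IsOpen U ∧ U ×ˢ U ⊆ V n}, fun n U hU => hU.1, fun n => ?_, ?_⟩
    · refine Set.eq_univ_of_forall fun x => ?_
      have hx : (x, x) ∈ V n := by
        have : (x, x) ∈ Set.diagonal T := rfl
        rw [hV] at this
        exact Set.mem_iInter.1 this n
      obtain ⟨A, B, hA, hB, hxA, hxB, hAB⟩ := isOpen_prod_iff.1 (hVo n) x x hx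
      exact ⟨A ∩ B, ⟨hA.inter hB,
        (Set.prod_mono Set.inter_subset_left Set.inter_subset_right).trans hAB⟩, hxA, hxB⟩
    · intro x y hxy
      by_contra! hc
      apply hxy
      have : (x, y) ∈ Set.diagonal T := by
        rw [hV]
        refine Set.mem_iInter.2 fun n => ?_
        obtain ⟨U, ⟨hU, hxU⟩, hyU⟩ := hc n
        exact hU.2 ⟨hxU, hyU⟩
      exact this
  · rintro ⟨G, hGo, hGc, hG⟩
    refine isGδ_iff_eq_iInter_nat.2
      ⟨fun n => ⋃ U ∈ G n, U ×ˢ U, fun n => ?_, ?_⟩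
    · exact isOpen_biUnion fun U hU => (hGo n U hU).prod (hGo n U hU)
    · ext ⟨x, y⟩
      simp only [Set.mem_diagonal_iff, Set.mem_iInter, Set.mem_iUnion, Set.mem_prod]
      constructor
      · rintro rfl n
        obtain ⟨U, hU, hx⟩ : x ∈ ⋃₀ G n := by rw [hGc n]; trivial
        exact ⟨U, hU, hx, hx⟩
      · intro h
        by_contra hxy
        obtain ⟨n, hn⟩ := hG x y hxy
        obtain ⟨U, hU, hxU, hyU⟩ := h n
        exact hn ⟨U, ⟨hU, hxU⟩, hyU⟩

/-- `H` is a `σ(X, F)`-open half-space of `X`. -/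
def IsOpenHalfSpace {X : Type u} [NormedAddCommGroup X] [NormedSpace ℝ X]
    (F : Submodule ℝ (StrongDual ℝ X)) (H : Set X) : Prop :=
  ∃ f ∈ F, f ≠ 0 ∧ ∃ a : ℝ, H = {x | a < f x}

/-- `A ⊆ X`, with the topology induced by `σ(X, F)`, has a G_δ-diagonal with `σ(X, F)`-slices:
it has a G_δ-diagonal sequence all of whose members are `σ(X, F)`-open slices of `A`,
i.e. intersections of `A` with `σ(X, F)`-open half-spaces. -/
def HasGdeltaDiagonalWithSlices {X : Type u} [NormedAddCommGroup X] [NormedSpace ℝ X]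
    (F : Submodule ℝ (StrongDual ℝ X)) (A : Set X) : Prop :=
  ∃ G : ℕ → Set (Set A),
    @IsGdeltaDiagonalSeq A
      (TopologicalSpace.induced Subtype.val (sigma (F : Set (StrongDual ℝ X)))) G ∧
    ∀ n, ∀ U ∈ G n, ∃ H : Set X, IsOpenHalfSpace F H ∧ U = Subtype.val ⁻¹' H

/-- `X` admits an equivalent `σ(X, F)`-lower semicontinuous rotund norm. -/
def AdmitsLscRotundNorm {X : Type u} [NormedAddCommGroup X] [NormedSpace ℝ X]
    (F : Submodule ℝ (StrongDual ℝ X)) : Prop :=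
  ∃ N : Seminorm ℝ X, IsEquivalentNorm N ∧ IsSigmaLsc F N ∧ IsRotund N

/-- `X` admits an equivalent `σ(X, F)`-lower semicontinuous norm whose unit sphere has a
G_δ-diagonal with `σ(X, F)`-slices. -/
def AdmitsLscGdeltaSliceNorm {X : Type u} [NormedAddCommGroup X] [NormedSpace ℝ X]
    (F : Submodule ℝ (StrongDual ℝ X)) : Prop :=
  ∃ N : Seminorm ℝ X, IsEquivalentNorm N ∧ IsSigmaLsc F N ∧
    HasGdeltaDiagonalWithSlices F (unitSphere N)

/-- The canonical image of `Y` in `Y**`, as a subspace of the dual of `Y*`. -/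
noncomputable def predual (Y : Type v) [NormedAddCommGroup Y] [NormedSpace ℝ Y] :
    Submodule ℝ (StrongDual ℝ (StrongDual ℝ Y)) :=
  LinearMap.range (NormedSpace.inclusionInDoubleDual ℝ Y).toLinearMap

/-- `N` is an equivalent dual norm on `Y*`: it is the dual norm of an equivalent norm `p` on
`Y`. -/
def IsEquivalentDualNorm {Y : Type v} [NormedAddCommGroup Y] [NormedSpace ℝ Y]
    (N : Seminorm ℝ (StrongDual ℝ Y)) : Prop :=
  ∃ p : Seminorm ℝ Y, IsEquivalentNorm p ∧
    ∀ f : StrongDual ℝ Y, IsLUB {r : ℝ | ∃ y : Y, p y ≤ 1 ∧ r = |f y|} (N f)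

/-- `Y*` admits an equivalent dual norm whose unit sphere has a G_δ-diagonal for the
weak* topology. -/
def AdmitsDualGdeltaNorm (Y : Type v) [NormedAddCommGroup Y] [NormedSpace ℝ Y] : Prop :=
  ∃ N : Seminorm ℝ (StrongDual ℝ Y), IsEquivalentDualNorm N ∧
    HasGdeltaDiagonal {f : WeakDual ℝ Y // WeakDual.toStrongDual f ∈ unitSphere N}

end Renorming

/-! From rotundity to covers: for a rotund lower semicontinuous norm `N`, the slices `{f > 1 -
1/(n+2)}` with `f ∈ F` and `|f| ≤ N` cover the unit sphere (`exists_slice`, a Hahn-Banach argument).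
Two points of the sphere sharing such a slice for every `n` have a midpoint of norm 1, so they
coincide. In a dual space these slices are weak* open and a weak* lower semicontinuous equivalent
norm is a dual norm, so the same covers give (3).

From covers to rotundity: a family of half-spaces `{f > a}` has an excess function, the supremum of
`(f - a)⁺`, which is convex and lower semicontinuous. If it agrees at `x`, `y` and their midpoint,
and the midpoint lies in some half-space of the family, then one half-space contains both `x` and
`y` (`exists_common_slice`); a separating sequence of covers excludes this. Adding `N²` and a
weighted sum of squares of countably many excess functions, symmetrized, gives an even convex
function. The gauge of one of its sublevel sets is the rotund norm, since equality at two points and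
their midpoint passes to every summand.

Slice covers supply the half-spaces directly. For weak* open covers, all slices whose sphere points
lie in one member of the cover are removed from the ball, and this is iterated (`derivedBall`). If a
point of the sphere survived every stage, the compact convex intersection of the stages would have
an extreme point on the sphere (`exists_mem_extremePoints_tendsto`). Choquet's lemma puts a slice of
the intersection around it inside a member of the cover, and compactness does the same at a finite
stage, so the point would have been removed. -/

namespace Renorming

open Set Filter Topology

/-! ### Excess functions of families of half-spaces. -/

section Excess

variable {X : Type*} [NormedAddCommGroup X] [NormedSpace ℝ X]

/-- The evaluation pairing between `X` and a subspace `F` of its dual. -/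
def pairing (F : Submodule ℝ (StrongDual ℝ X)) : X →ₗ[ℝ] F →ₗ[ℝ] ℝ :=
  (ContinuousLinearMap.coeLM ℝ ∘ₗ F.subtype).flip

/-- The space `X` with the locally convex topology `σ(X, F)`. -/
abbrev SigmaSpace (F : Submodule ℝ (StrongDual ℝ X)) : Type _ := WeakBilin (pairing F)

/-- `σ(X, F)`-lower semicontinuity of a real function on `X`. -/
def SigmaLowerSemicontinuous (F : Submodule ℝ (StrongDual ℝ X)) (φ : X → ℝ) : Prop :=
  LowerSemicontinuous (fun x : SigmaSpace F => φ x)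

theorem isSigmaLsc_iff {F : Submodule ℝ (StrongDual ℝ X)} {N : Seminorm ℝ X} :
    IsSigmaLsc F N ↔ SigmaLowerSemicontinuous F N := Iff.rfl

theorem sigmaLowerSemicontinuous_iff {F : Submodule ℝ (StrongDual ℝ X)} {φ : X → ℝ} :
    SigmaLowerSemicontinuous F φ ↔ ∀ c : ℝ, IsClosed {x : SigmaSpace F | φ x ≤ c} :=
  lowerSemicontinuous_iff_isClosed_preimage

theorem continuous_sigma_of_mem {F : Submodule ℝ (StrongDual ℝ X)} {f : StrongDual ℝ X}
    (hf : f ∈ F) : Continuous (fun x : SigmaSpace F => f x) :=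
  WeakBilin.eval_continuous (pairing F) ⟨f, hf⟩

/-- The largest amount by which a point exceeds the level of a half-space `{f > a}`,
`(f, a) ∈ P`. -/
noncomputable def excess (P : Set (StrongDual ℝ X × ℝ)) (x : X) : ℝ :=
  ⨆ q : P, max (q.1.1 x - q.1.2) 0

/-- The members of `P` are half-spaces given by functionals of `F` that are dominated by `N`, with
levels bounded below. -/
def IsSliceFamily (F : Submodule ℝ (StrongDual ℝ X)) (N : Seminorm ℝ X)
    (P : Set (StrongDual ℝ X × ℝ)) : Prop :=
  ∀ q ∈ P, q.1 ∈ F ∧ (∀ x, q.1 x ≤ N x) ∧ -2 ≤ q.2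

variable {F : Submodule ℝ (StrongDual ℝ X)} {N : Seminorm ℝ X} {P : Set (StrongDual ℝ X × ℝ)}

theorem excess_nonneg (P : Set (StrongDual ℝ X × ℝ)) (x : X) : 0 ≤ excess P x :=
  Real.iSup_nonneg fun _ => le_max_right _ _

theorem excess_le {x : X} {c : ℝ} (hc : 0 ≤ c) (h : ∀ q ∈ P, q.1 x - q.2 ≤ c) :
    excess P x ≤ c :=
  Real.iSup_le (fun q => max_le (h q.1 q.2) hc) hc

namespace IsSliceFamily

theorem bddAbove (hP : IsSliceFamily F N P) (x : X) :
    BddAbove (range fun q : P => max (q.1.1 x - q.1.2) 0) := by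
  refine ⟨2 + N x, ?_⟩
  rintro _ ⟨q, rfl⟩
  have h := hP q.1 q.2
  exact max_le (by linarith [h.2.1 x, h.2.2]) (by linarith [apply_nonneg N x])

theorem le_excess (hP : IsSliceFamily F N P) {q : StrongDual ℝ X × ℝ} (hq : q ∈ P) (x : X) :
    q.1 x - q.2 ≤ excess P x :=
  (le_max_left _ _).trans (le_ciSup (hP.bddAbove x) ⟨q, hq⟩)

theorem excess_le_add (hP : IsSliceFamily F N P) (x : X) : excess P x ≤ 2 + N x :=
  excess_le (by linarith [apply_nonneg N x]) fun q hq => by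
    linarith [(hP q hq).2.1 x, (hP q hq).2.2]

theorem convexOn_excess (hP : IsSliceFamily F N P) : ConvexOn ℝ univ (excess P) := by
  refine ⟨convex_univ, fun x _ y _ a b ha hb hab => ?_⟩
  refine excess_le (add_nonneg (mul_nonneg ha (excess_nonneg P x))
    (mul_nonneg hb (excess_nonneg P y))) fun q hq => ?_
  have h1 := mul_le_mul_of_nonneg_left (hP.le_excess hq x) ha
  have h2 := mul_le_mul_of_nonneg_left (hP.le_excess hq y) hb
  have h3 : q.2 = a * q.2 + b * q.2 := by rw [← add_mul, hab, one_mul]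
  simp only [map_add, map_smul, smul_eq_mul]
  linarith

theorem sigmaLowerSemicontinuous_excess (hP : IsSliceFamily F N P) :
    SigmaLowerSemicontinuous F (excess P) := by
  refine lowerSemicontinuous_ciSup (f := fun (q : P) (x : SigmaSpace F) =>
    max (q.1.1 x - q.1.2) 0) (fun x => hP.bddAbove x) fun q => Continuous.lowerSemicontinuous ?_
  exact ((continuous_sigma_of_mem (hP q.1 q.2).1).sub continuous_const).max continuous_const

/-- If the excess takes the same positive value at two points and at their midpoint, then the two
points lie in a common half-space of the family. -/
theorem exists_common_slice (hP : IsSliceFamily F N P) {x y : X}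
    (hxy : excess P x = excess P y) (hxz : excess P x = excess P ((1 / 2 : ℝ) • (x + y)))
    (hz : ∃ q ∈ P, q.2 < q.1 ((1 / 2 : ℝ) • (x + y))) :
    ∃ q ∈ P, q.2 < q.1 x ∧ q.2 < q.1 y := by
  obtain ⟨q₀, hq₀, hlt⟩ := hz
  have hpos : 0 < excess P x := by
    rw [hxz]
    exact (sub_pos.2 hlt).trans_le (hP.le_excess hq₀ _)
  by_contra! hcon
  -- Without a common half-space, one of `q x - a`, `q y - a` is nonpositive for each member and the
  -- other is at most the common excess, so the average is at most half of it.
  have : excess P ((1 / 2 : ℝ) • (x + y)) ≤ excess P x / 2 := by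
    refine excess_le (by linarith) fun q hq => ?_
    simp only [map_add, map_smul, smul_eq_mul]
    have h1 := hP.le_excess hq x
    have h2 := hP.le_excess hq y
    rw [← hxy] at h2
    by_cases h : q.2 < q.1 x
    · linarith [hcon q hq h]
    · linarith [not_lt.1 h]
  linarith

end IsSliceFamily

end Excess

/-! ### Weighted sums of squares and equality in midpoint convexity. -/

section WeightedSum

/-- A weighted sum of the squares of a sequence of functions. -/
noncomputable def sqSum {X : Type*} (Φ : ℕ → X → ℝ) (x : X) : ℝ := ∑' j, (1 / 2 : ℝ) ^ j * Φ j x ^ 2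

theorem sqSum_nonneg {X : Type*} (Φ : ℕ → X → ℝ) (x : X) : 0 ≤ sqSum Φ x :=
  tsum_nonneg fun j => by positivity

variable {X : Type*} [NormedAddCommGroup X] [NormedSpace ℝ X]

/-- A convex `σ(X, F)`-lower semicontinuous function between `0` and `1 + N`. -/
structure IsTame (F : Submodule ℝ (StrongDual ℝ X)) (N : Seminorm ℝ X) (φ : X → ℝ) : Prop where
  nonneg : ∀ x, 0 ≤ φ x
  le_add : ∀ x, φ x ≤ 1 + N x
  convexOn : ConvexOn ℝ univ φ
  lsc : SigmaLowerSemicontinuous F φ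

variable {F : Submodule ℝ (StrongDual ℝ X)} {N : Seminorm ℝ X} {Φ : ℕ → X → ℝ}

theorem summable_sqSum (hΦ : ∀ j, IsTame F N (Φ j)) (x : X) :
    Summable fun j => (1 / 2 : ℝ) ^ j * Φ j x ^ 2 := by
  refine Summable.of_nonneg_of_le (fun j => by positivity) (fun j => ?_)
    (summable_geometric_two.mul_right ((1 + N x) ^ 2))
  have h1 := (hΦ j).nonneg x
  have h2 := (hΦ j).le_add x
  gcongr

theorem sqSum_le (hΦ : ∀ j, IsTame F N (Φ j)) (x : X) : sqSum Φ x ≤ 2 * (1 + N x) ^ 2 := by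
  rw [← tsum_geometric_two, ← tsum_mul_right]
  refine (summable_sqSum hΦ x).tsum_le_tsum (fun j => ?_)
    (summable_geometric_two.mul_right ((1 + N x) ^ 2))
  have h1 := (hΦ j).nonneg x
  have h2 := (hΦ j).le_add x
  gcongr

theorem convexOn_sqSum (hΦ : ∀ j, IsTame F N (Φ j)) : ConvexOn ℝ univ (sqSum Φ) := by
  refine ⟨convex_univ, fun x _ y _ a b ha hb hab => ?_⟩
  simp only [sqSum, smul_eq_mul]
  rw [← tsum_mul_left, ← tsum_mul_left, ← ((summable_sqSum hΦ x).mul_left a).tsum_add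
    ((summable_sqSum hΦ y).mul_left b)]
  refine (summable_sqSum hΦ _).tsum_le_tsum (fun j => ?_)
    (((summable_sqSum hΦ x).mul_left a).add ((summable_sqSum hΦ y).mul_left b))
  have := ((hΦ j).convexOn.pow (fun x _ => (hΦ j).nonneg x) 2).2 (mem_univ x) (mem_univ y) ha hb hab
  simp only [Pi.pow_apply, smul_eq_mul] at this
  calc _ ≤ (1 / 2 : ℝ) ^ j * (a * Φ j x ^ 2 + b * Φ j y ^ 2) := by gcongr
    _ = _ := by ring

theorem SigmaLowerSemicontinuous.sq {φ : X → ℝ} (h : SigmaLowerSemicontinuous F φ)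
    (h0 : ∀ x, 0 ≤ φ x) : SigmaLowerSemicontinuous F (fun x => φ x ^ 2) := by
  -- Truncation makes squaring monotone on all of `ℝ`, as composition with a lower semicontinuous
  -- function requires.
  have hmono : Monotone fun t : ℝ => max t 0 ^ 2 := fun s t hst => by
    have : max s 0 ≤ max t 0 := max_le_max_right 0 hst
    have : (0 : ℝ) ≤ max s 0 := le_max_right _ _
    dsimp only
    gcongr
  have hc : Continuous fun t : ℝ => max t 0 ^ 2 := by fun_prop
  have := hc.comp_lowerSemicontinuous h hmono
  have e : (fun x : SigmaSpace F => φ x ^ 2) =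
      (fun t : ℝ => max t 0 ^ 2) ∘ fun x : SigmaSpace F => φ x :=
    funext fun x => by simp only [Function.comp_apply, max_eq_left (h0 x)]
  exact (congrArg LowerSemicontinuous e).mpr this

theorem SigmaLowerSemicontinuous.comp_smul {φ : X → ℝ} (h : SigmaLowerSemicontinuous F φ)
    (c : ℝ) : SigmaLowerSemicontinuous F (fun x => φ (c • x)) :=
  LowerSemicontinuous.comp (f := fun x : SigmaSpace F => φ x) h
    (continuous_const_smul (T := SigmaSpace F) c)

theorem SigmaLowerSemicontinuous.const_mul {φ : X → ℝ} (h : SigmaLowerSemicontinuous F φ)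
    {c : ℝ} (hc : 0 ≤ c) : SigmaLowerSemicontinuous F (fun x => c * φ x) :=
  (continuous_const_mul c).comp_lowerSemicontinuous h (monotone_mul_left_of_nonneg hc)

theorem sigmaLowerSemicontinuous_sqSum (hΦ : ∀ j, IsTame F N (Φ j)) :
    SigmaLowerSemicontinuous F (sqSum Φ) := by
  intro x c hc
  have hs := (summable_sqSum hΦ x).hasSum
  obtain ⟨s, hs⟩ := (hs.eventually (lt_mem_nhds hc)).exists
  have hl : LowerSemicontinuous fun x : SigmaSpace F => ∑ j ∈ s, (1 / 2 : ℝ) ^ j * Φ j x ^ 2 :=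
    lowerSemicontinuous_sum fun j _ =>
      ((hΦ j).lsc.sq (hΦ j).nonneg).const_mul (by positivity)
  filter_upwards [hl x c hs] with y hy
  exact hy.trans_le ((summable_sqSum hΦ y).sum_le_tsum s fun j _ => by positivity)

/-- Equality in the midpoint convexity of the square forces equality of the values. -/
theorem eq_of_sq_midpoint {u v m : ℝ} (hu : 0 ≤ u) (hv : 0 ≤ v) (hm : 0 ≤ m)
    (h : m ≤ (u + v) / 2) (h' : (u ^ 2 + v ^ 2) / 2 ≤ m ^ 2) : u = v ∧ u = m := by
  have h1 : (u - v) ^ 2 ≤ 0 := by nlinarith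
  have h2 : u = v := sub_eq_zero.1 (pow_eq_zero_iff two_ne_zero |>.1
    (le_antisymm h1 (sq_nonneg (u - v))))
  subst h2
  refine ⟨rfl, le_antisymm ?_ (by linarith)⟩
  nlinarith

theorem midpoint_le {φ : X → ℝ} (h : ConvexOn ℝ univ φ) (x y : X) :
    φ ((1 / 2 : ℝ) • (x + y)) ≤ (φ x + φ y) / 2 := by
  have := h.2 (mem_univ x) (mem_univ y) (show (0 : ℝ) ≤ 1 / 2 by norm_num)
    (show (0 : ℝ) ≤ 1 / 2 by norm_num) (by norm_num)
  rw [← smul_add] at this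
  simp only [smul_eq_mul] at this
  linarith

/-- Every term satisfies the midpoint inequality, so strictness in a single one would make the
inequality between the sums strict. -/
theorem eq_of_sqSum_midpoint (hΦ : ∀ j, IsTame F N (Φ j)) {x y : X}
    (h : (sqSum Φ x + sqSum Φ y) / 2 ≤ sqSum Φ ((1 / 2 : ℝ) • (x + y))) (j : ℕ) :
    Φ j x = Φ j y ∧ Φ j x = Φ j ((1 / 2 : ℝ) • (x + y)) := by
  have hmid := fun i => midpoint_le (hΦ i).convexOn x y
  refine eq_of_sq_midpoint ((hΦ j).nonneg _) ((hΦ j).nonneg _) ((hΦ j).nonneg _) (hmid j) ?_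
  by_contra! hlt
  have hsum := (((summable_sqSum hΦ x).add (summable_sqSum hΦ y)).div_const 2)
  have : sqSum Φ ((1 / 2 : ℝ) • (x + y)) < (sqSum Φ x + sqSum Φ y) / 2 := by
    simp only [sqSum]
    rw [← (summable_sqSum hΦ x).tsum_add (summable_sqSum hΦ y), ← tsum_div_const]
    refine (summable_sqSum hΦ _).tsum_lt_tsum (i := j) (fun i => ?_) ?_ hsum
    · have h1 : Φ i ((1 / 2 : ℝ) • (x + y)) ^ 2 ≤ (Φ i x ^ 2 + Φ i y ^ 2) / 2 := by
        have := hmid i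
        have := (hΦ i).nonneg ((1 / 2 : ℝ) • (x + y))
        nlinarith [sq_nonneg (Φ i x - Φ i y)]
      calc _ ≤ (1 / 2 : ℝ) ^ i * ((Φ i x ^ 2 + Φ i y ^ 2) / 2) := by gcongr
        _ = _ := by ring
    · calc _ < (1 / 2 : ℝ) ^ j * ((Φ j x ^ 2 + Φ j y ^ 2) / 2) := by gcongr
        _ = _ := by ring
  linarith

end WeightedSum

/-! ### The rotund norm as the gauge of a sublevel set. -/

section Gauge

variable {X : Type*} [NormedAddCommGroup X] [NormedSpace ℝ X]
  {F : Submodule ℝ (StrongDual ℝ X)} {N : Seminorm ℝ X} {Φ : ℕ → X → ℝ}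

theorem convexOn_seminorm_sq (N : Seminorm ℝ X) : ConvexOn ℝ univ fun x => N x ^ 2 :=
  N.convexOn.pow (fun _ _ => apply_nonneg N _) 2

/-- The even convex function whose sublevel set is the unit ball of the rotund norm. -/
noncomputable def ballFun (N : Seminorm ℝ X) (Φ : ℕ → X → ℝ) (x : X) : ℝ :=
  N x ^ 2 + (sqSum Φ x + sqSum Φ ((-1 : ℝ) • x))

theorem convexOn_ballFun (hΦ : ∀ j, IsTame F N (Φ j)) : ConvexOn ℝ univ (ballFun N Φ) :=
  (convexOn_seminorm_sq N).add ((convexOn_sqSum hΦ).add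
    ((convexOn_sqSum hΦ).comp_linearMap ((-1 : ℝ) • (LinearMap.id : X →ₗ[ℝ] X))))

theorem ballFun_neg (N : Seminorm ℝ X) (Φ : ℕ → X → ℝ) (x : X) :
    ballFun N Φ (-x) = ballFun N Φ x := by
  simp only [ballFun, map_neg_eq_map, neg_smul, one_smul, neg_neg]
  ring

theorem sigmaLowerSemicontinuous_ballFun (hN : IsSigmaLsc F N) (hΦ : ∀ j, IsTame F N (Φ j)) :
    SigmaLowerSemicontinuous F (ballFun N Φ) :=
  LowerSemicontinuous.add (SigmaLowerSemicontinuous.sq (isSigmaLsc_iff.1 hN) (apply_nonneg N))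
    (LowerSemicontinuous.add (sigmaLowerSemicontinuous_sqSum hΦ)
      ((sigmaLowerSemicontinuous_sqSum hΦ).comp_smul (-1)))

/-- A convex function bounded above near one point is continuous. -/
theorem continuous_ballFun (hN : IsEquivalentNorm N) (hΦ : ∀ j, IsTame F N (Φ j)) :
    Continuous (ballFun N Φ) := by
  obtain ⟨c, C, hc, hC, hb⟩ := hN
  rw [← continuousOn_univ]
  have tfae := ((convexOn_ballFun hΦ).continuousOn_tfae isOpen_univ univ_nonempty).out 3 1
  refine tfae.1 ⟨0, mem_univ _, C ^ 2 + (2 * (1 + C) ^ 2 + 2 * (1 + C) ^ 2), ?_⟩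
  simp only [eventually_map]
  filter_upwards [Metric.ball_mem_nhds (0 : X) one_pos] with x hx
  have hx1 : N x ≤ C := (hb x).2.trans (by
    have : ‖x‖ ≤ 1 := (mem_ball_zero_iff.1 hx).le
    nlinarith)
  have h0 := apply_nonneg N x
  have h1 := sqSum_le hΦ x
  have h2 := sqSum_le hΦ ((-1 : ℝ) • x)
  have h3 : N ((-1 : ℝ) • x) = N x := by simp
  rw [h3] at h2
  have h4 : (1 + N x) ^ 2 ≤ (1 + C) ^ 2 := by gcongr
  have h5 : N x ^ 2 ≤ C ^ 2 := by gcongr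
  simp only [ballFun]
  linarith

theorem eq_of_ballFun_midpoint (hΦ : ∀ j, IsTame F N (Φ j)) {x y : X}
    (hxy : ballFun N Φ x = ballFun N Φ y)
    (hxz : ballFun N Φ x = ballFun N Φ ((1 / 2 : ℝ) • (x + y))) :
    (N x = N y ∧ N x = N ((1 / 2 : ℝ) • (x + y))) ∧
      ∀ j, Φ j x = Φ j y ∧ Φ j x = Φ j ((1 / 2 : ℝ) • (x + y)) := by
  have h1 := midpoint_le (convexOn_seminorm_sq N) x y
  have h2 := midpoint_le (convexOn_sqSum hΦ) x y
  have h3 := midpoint_le ((convexOn_sqSum hΦ).comp_linearMap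
    ((-1 : ℝ) • (LinearMap.id : X →ₗ[ℝ] X))) x y
  simp only [Function.comp_apply, LinearMap.smul_apply, LinearMap.id_apply, ballFun]
    at h1 h2 h3 hxy hxz
  exact ⟨eq_of_sq_midpoint (apply_nonneg N _) (apply_nonneg N _) (apply_nonneg N _)
    (midpoint_le N.convexOn x y) (by linarith), eq_of_sqSum_midpoint hΦ (by linarith)⟩

/-- An equivalent lower semicontinuous norm can be made rotund if there is a sequence of convex
lower semicontinuous functions which, together with the norm, do not all take the same value at
two different points and their midpoint. -/
theorem admitsLscRotundNorm_of_isTame (hN : IsEquivalentNorm N) (hlsc : IsSigmaLsc F N)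
    (hΦ : ∀ j, IsTame F N (Φ j))
    (hsep : ∀ x y : X, N x = N y → N x = N ((1 / 2 : ℝ) • (x + y)) →
      (∀ j, Φ j x = Φ j y ∧ Φ j x = Φ j ((1 / 2 : ℝ) • (x + y))) → x = y) :
    AdmitsLscRotundNorm F := by
  set θ := ballFun N Φ with hθ
  -- Any level above `θ 0` makes the origin an interior point of the sublevel set.
  set c : ℝ := θ 0 + 1 with hc
  have hcont : Continuous θ := continuous_ballFun hN hΦ
  have hθN : ∀ x, N x ^ 2 ≤ θ x := fun x =>
    le_add_of_nonneg_right (add_nonneg (sqSum_nonneg _ _) (sqSum_nonneg _ _))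
  have hc0 : 0 < c := by linarith [(sq_nonneg _).trans (hθN 0)]
  set s : Set X := {x | θ x ≤ c} with hs
  have hconv : Convex ℝ s := by
    simpa using (convexOn_ballFun hΦ).convex_le c
  have hclosed : IsClosed s := isClosed_le hcont continuous_const
  have hnhds : s ∈ 𝓝 (0 : X) := by
    filter_upwards [hcont.continuousAt.eventually (gt_mem_nhds (show θ 0 < c by linarith))]
      with x hx using hx.le
  have hbal : Balanced ℝ s := (balanced_iff_neg_mem hconv).2 fun x hx => by
    simpa only [hs, mem_ofPred_eq, hθ, ballFun_neg] using hx
  have habs : Absorbent ℝ s := absorbent_nhds_zero hnhds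
  set p : Seminorm ℝ X := gaugeSeminorm hbal hconv habs with hp
  have hp_apply : ∀ x, p x = gauge s x := fun x => rfl
  have hple : ∀ x, p x ≤ 1 ↔ θ x ≤ c := fun x => by
    rw [hp_apply, gauge_le_one_iff_mem_closure hconv hnhds, hclosed.closure_eq]; rfl
  have hpeq : ∀ x, p x = 1 → θ x = c := fun x hx => by
    rw [hp_apply, gauge_eq_one_iff_mem_frontier hconv hnhds] at hx
    exact frontier_le_subset_eq hcont continuous_const hx
  obtain ⟨a, b, ha, hb, hab⟩ := hN
  have hlow : ∀ x, a / √c * ‖x‖ ≤ p x := fun x => by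
    have hsub : s ⊆ Metric.closedBall 0 (√c / a) := fun y hy => by
      rw [mem_closedBall_zero_iff, le_div_iff₀ ha, mul_comm]
      exact (hab y).1.trans (Real.le_sqrt_of_sq_le ((hθN y).trans hy))
    have := le_gauge_of_subset_closedBall (x := x) habs (by positivity) hsub
    rw [hp_apply]
    refine le_trans (le_of_eq ?_) this
    field_simp
  have hlowpos : 0 < a / √c := div_pos ha (Real.sqrt_pos.2 hc0)
  refine ⟨p, ?_, ?_, ?_⟩
  · obtain ⟨r, hr, hball⟩ := Metric.mem_nhds_iff.1 hnhds
    refine ⟨a / √c, r⁻¹, hlowpos, inv_pos.2 hr, fun x => ⟨hlow x, ?_⟩⟩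
    rw [← div_eq_inv_mul, le_div_iff₀ hr, mul_comm, hp_apply]
    exact mul_gauge_le_norm hball
  · rw [isSigmaLsc_iff, sigmaLowerSemicontinuous_iff]
    intro r
    rcases lt_or_ge r 0 with hr | hr
    · convert isClosed_empty
      exact eq_empty_of_forall_notMem fun x hx => (hr.trans_le (apply_nonneg p (x : X))).not_ge hx
    -- Using all `t > r` avoids dividing by `r`, which may be zero.
    have hset : {x : SigmaSpace F | p x ≤ r} =
        ⋂ t : {t : ℝ // r < t}, {x : SigmaSpace F | θ ((t : ℝ)⁻¹ • show X from x) ≤ c} := by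
      refine Set.ext fun (x : X) => ?_
      change p x ≤ r ↔ x ∈ ⋂ t : {t : ℝ // r < t}, {x : X | θ ((t : ℝ)⁻¹ • x) ≤ c}
      simp only [mem_iInter, mem_ofPred_eq]
      have key : ∀ t : ℝ, 0 < t → (θ (t⁻¹ • x) ≤ c ↔ p x ≤ t) := fun t ht => by
        rw [← hple, map_smul_eq_mul, norm_inv, Real.norm_of_nonneg ht.le, ← div_eq_inv_mul,
          div_le_one ht]
      constructor
      · rintro h ⟨t, ht⟩
        exact (key t (hr.trans_lt ht)).2 (h.trans ht.le)
      · intro h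
        exact le_of_forall_gt_imp_ge_of_dense fun t ht =>
          (key t (hr.trans_lt ht)).1 (h ⟨t, ht⟩)
    rw [hset]
    refine isClosed_iInter fun t => ?_
    exact sigmaLowerSemicontinuous_iff.1
      ((sigmaLowerSemicontinuous_ballFun hlsc hΦ).comp_smul _) c
  · intro x y hxy hxz
    rcases (apply_nonneg p x).eq_or_lt with h0 | h0
    · have hz : ∀ w, p w = 0 → w = 0 := fun w hw => by
        have := hlow w
        rw [hw] at this
        exact norm_le_zero_iff.1 (nonpos_of_mul_nonpos_right this hlowpos)
      rw [hz x h0.symm, hz y (hxy ▸ h0.symm)]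
    · set t : ℝ := (p x)⁻¹ with ht
      have ht0 : 0 < t := inv_pos.2 h0
      have hscale : ∀ w, p w = p x → θ (t • w) = c := fun w hw => hpeq _ (by
        rw [map_smul_eq_mul, Real.norm_of_nonneg ht0.le, hw, ht, inv_mul_cancel₀ h0.ne'])
      have hmid : (1 / 2 : ℝ) • (t • x + t • y) = t • ((1 / 2 : ℝ) • (x + y)) := by
        rw [← smul_add, smul_comm]
      have h1 := hscale x rfl
      have h2 := hscale y hxy.symm
      have h3 := hscale _ hxz.symm
      rw [← hmid] at h3
      have h4 := eq_of_ballFun_midpoint hΦ (h1.trans h2.symm) (h1.trans h3.symm)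
      exact smul_right_injective X ht0.ne' (hsep _ _ h4.1.1 h4.1.2 h4.2)

end Gauge

/-! ### Separation, slice families and derived sets; the equivalence of (1) and (2). -/

section Slices

theorem exists_separation_weakBilin {E G : Type*} [AddCommGroup E] [Module ℝ E] [AddCommMonoid G]
    [Module ℝ G] (B : E →ₗ[ℝ] G →ₗ[ℝ] ℝ) {s : Set E} (hs : Convex ℝ s)
    (hcl : IsClosed (X := WeakBilin B) s) {x : E} (hx : x ∉ s) :
    ∃ (y : G) (u : ℝ), (∀ a ∈ s, B a y < u) ∧ u < B x y := by
  let _ : AddCommGroup G := Module.addCommMonoidToAddCommGroup ℝ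
  obtain ⟨g, u, hg, hu⟩ := geometric_hahn_banach_closed_point (E := WeakBilin B) hs hcl hx
  obtain ⟨y, rfl⟩ := LinearMap.dualEmbedding_surjective B g
  exact ⟨y, u, hg, hu⟩

variable {X : Type*} [NormedAddCommGroup X] [NormedSpace ℝ X]
  {F : Submodule ℝ (StrongDual ℝ X)} {N : Seminorm ℝ X}

theorem exists_slice (hN : IsSigmaLsc F N) {t : ℝ} (ht : 0 < t)
    {x : X} (hx : t < N x) : ∃ f ∈ F, (∀ y, |f y| ≤ N y) ∧ t < f x := by
  have hcl : IsClosed {y : SigmaSpace F | N y ≤ t} :=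
    sigmaLowerSemicontinuous_iff.1 (isSigmaLsc_iff.1 hN) t
  have hcv : Convex ℝ {y : X | N y ≤ t} := by
    simpa using N.convexOn.convex_le t
  obtain ⟨⟨f, hf⟩, u, hg, hu⟩ := exists_separation_weakBilin (pairing F) hcv hcl (not_le.2 hx)
  change ∀ y : X, N y ≤ t → f y < u at hg
  change u < f x at hu
  have hu0 : 0 < u := by simpa using hg 0 (by simpa using ht.le)
  -- As `f < u` on the ball of radius `t`, homogeneity gives `f ≤ (u / t) N`; this factor normalizes
  -- the bound to `N` and moves the level `u` to `t`.
  refine ⟨(t / u) • f, F.smul_mem _ hf, fun y => ?_, ?_⟩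
  · have key : ∀ y, f y ≤ u / t * N y := fun y => by
      refine le_of_forall_pos_le_add fun ε hε => ?_
      -- The slack keeps the denominator positive even if `N y = 0`, and becomes `ε` after
      -- multiplication by `u / t`.
      have hpos : 0 < N y + ε * t / u := by positivity
      have h := (hg ((t / (N y + ε * t / u)) • y) (by
        rw [map_smul_eq_mul, Real.norm_of_nonneg (by positivity), div_mul_eq_mul_div,
          div_le_iff₀ hpos]
        gcongr
        linarith [show 0 < ε * t / u by positivity])).le
      rw [map_smul, smul_eq_mul, div_mul_eq_mul_div, div_le_iff₀ hpos] at h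
      rw [div_mul_eq_mul_div, ← sub_le_iff_le_add, le_div_iff₀ ht]
      have : u * (ε * t / u) = ε * t := by field_simp
      nlinarith
    have key' : ∀ y, t / u * f y ≤ N y := fun y => by
      have h := mul_le_mul_of_nonneg_left (key y) (div_pos ht hu0).le
      have e : t / u * (u / t * N y) = N y := by field_simp
      rwa [e] at h
    have h2 := key' (-y)
    rw [map_neg, map_neg_eq_map] at h2
    simp only [smul_apply, smul_eq_mul]
    exact abs_le.2 ⟨by linarith, key' y⟩
  · simp only [smul_apply, smul_eq_mul]
    rw [div_mul_eq_mul_div, lt_div_iff₀ hu0]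
    gcongr

theorem IsEquivalentNorm.eq_zero (hN : IsEquivalentNorm N) {x : X} (hx : N x = 0) : x = 0 := by
  obtain ⟨c, C, hc, -, h⟩ := hN
  have := (h x).1
  rw [hx] at this
  exact norm_le_zero_iff.1 (nonpos_of_mul_nonpos_right this hc)

theorem IsEquivalentNorm.exists_smul_le (hN : IsEquivalentNorm N) (f : StrongDual ℝ X) :
    ∃ c : ℝ, 0 < c ∧ ∀ x, |c * f x| ≤ N x := by
  obtain ⟨c, C, hc, -, h⟩ := hN
  have hf : 0 < ‖f‖ + 1 := by positivity
  refine ⟨c / (‖f‖ + 1), by positivity, fun x => ?_⟩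
  rw [abs_mul, abs_of_pos (by positivity), div_mul_eq_mul_div, div_le_iff₀ hf]
  have h1 : |f x| ≤ ‖f‖ * ‖x‖ := f.le_opNorm x
  have h2 := (h x).1
  nlinarith [norm_nonneg x, norm_nonneg f, mul_le_mul_of_nonneg_left h1 hc.le,
    mul_le_mul_of_nonneg_left h2 (norm_nonneg f)]

theorem continuous_excess_smul {P : Set (StrongDual ℝ X × ℝ)} (hP : IsSliceFamily F N P) (x : X) :
    Continuous fun t : ℝ => excess P (t • x) := by
  have h := hP.convexOn_excess.comp_linearMap (LinearMap.toSpanSingleton ℝ X x)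
  exact continuousOn_univ.1 (h.continuousOn isOpen_univ)

/-- Slice families that separate the points of the unit sphere of `N` yield a rotund norm. -/
theorem admitsLscRotundNorm_of_excess {ι : Type*} [Countable ι] [Nonempty ι]
    (hN : IsEquivalentNorm N) (hlsc : IsSigmaLsc F N) {P : ι → Set (StrongDual ℝ X × ℝ)}
    (hP : ∀ i, IsSliceFamily F N (P i))
    (hsep : ∀ x y : X, N x = 1 → N y = 1 → N ((1 / 2 : ℝ) • (x + y)) = 1 →
      (∀ i, excess (P i) x = excess (P i) y ∧
        excess (P i) x = excess (P i) ((1 / 2 : ℝ) • (x + y))) → x = y) :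
    AdmitsLscRotundNorm F := by
  have : Nonempty {q : ℚ // 0 < q} := ⟨⟨1, one_pos⟩⟩
  obtain ⟨e, he⟩ := exists_surjective_nat (ι × {q : ℚ // 0 < q})
  -- The new unit sphere is not that of `N`, so the excess is recorded at all positive rational
  -- dilations. The factor comes from `2 + q N x ≤ (2 + q)(1 + N x)`.
  refine admitsLscRotundNorm_of_isTame (Φ := fun j x => (2 + ((e j).2 : ℚ) : ℝ)⁻¹ *
    excess (P (e j).1) ((((e j).2 : ℚ) : ℝ) • x)) hN hlsc (fun j => ?_) fun x y hxy hxz hΦ => ?_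
  · have hq : (0 : ℝ) < ((e j).2 : ℚ) := Rat.cast_pos.2 (e j).2.2
    generalize (((e j).2 : ℚ) : ℝ) = q at hq
    have hPj := hP (e j).1
    refine ⟨fun x => mul_nonneg (by positivity) (excess_nonneg _ _), fun x => ?_, ?_,
      (hPj.sigmaLowerSemicontinuous_excess.comp_smul q).const_mul (by positivity)⟩
    · rw [← div_eq_inv_mul, div_le_iff₀ (by positivity)]
      have := hPj.excess_le_add (q • x)
      rw [map_smul_eq_mul, Real.norm_of_nonneg hq.le] at this
      nlinarith [apply_nonneg N x]
    · exact (hPj.convexOn_excess.comp_linearMap (q • (LinearMap.id : X →ₗ[ℝ] X))).smul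
        (c := (2 + q)⁻¹) (by positivity)
  · rcases (apply_nonneg N x).eq_or_lt with h0 | h0
    · rw [hN.eq_zero h0.symm, hN.eq_zero (x := y) (hxy ▸ h0.symm)]
    -- Continuity along rays passes from rational dilations to real ones, in particular to `(N
    -- x)⁻¹`.
    have hdense : ∀ (i : ι) (u v : X), (∀ q : ℚ, 0 < q → excess (P i) ((q : ℝ) • u) =
        excess (P i) ((q : ℝ) • v)) → ∀ t : ℝ, 0 < t →
        excess (P i) (t • u) = excess (P i) (t • v) := by
      intro i u v h t ht
      by_contra hne
      have hopen : IsOpen ({t : ℝ | excess (P i) (t • u) ≠ excess (P i) (t • v)} ∩ Ioi 0) :=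
        (isOpen_ne_fun (continuous_excess_smul (hP i) u)
          (continuous_excess_smul (hP i) v)).inter isOpen_Ioi
      obtain ⟨q, hq, hq0⟩ := Rat.denseRange_cast.exists_mem_open hopen ⟨t, hne, ht⟩
      exact hq (h q (Rat.cast_pos.1 (mem_Ioi.1 hq0)))
    have hrat : ∀ (i : ι) (q : ℚ), 0 < q →
        excess (P i) ((q : ℝ) • x) = excess (P i) ((q : ℝ) • y) ∧
        excess (P i) ((q : ℝ) • x) = excess (P i) ((q : ℝ) • ((1 / 2 : ℝ) • (x + y))) := by
      intro i q hq
      obtain ⟨j, hj⟩ := he (i, ⟨q, hq⟩)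
      have hq' : (0 : ℝ) < q := Rat.cast_pos.2 hq
      have h := hΦ j
      simp only [hj] at h
      have hne : (2 + (q : ℝ))⁻¹ ≠ 0 := by positivity
      exact ⟨mul_left_cancel₀ hne h.1, mul_left_cancel₀ hne h.2⟩
    set t : ℝ := (N x)⁻¹ with ht
    have ht0 : 0 < t := inv_pos.2 h0
    have hscale : ∀ w, N w = N x → N (t • w) = 1 := fun w hw => by
      rw [map_smul_eq_mul, Real.norm_of_nonneg ht0.le, hw, ht, inv_mul_cancel₀ h0.ne']
    have hmid : (1 / 2 : ℝ) • (t • x + t • y) = t • ((1 / 2 : ℝ) • (x + y)) := by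
      rw [← smul_add, smul_comm]
    refine smul_right_injective X ht0.ne' (hsep _ _ (hscale x rfl) (hscale y hxy.symm)
      (by rw [hmid]; exact hscale _ hxz.symm) fun i => ?_)
    rw [hmid]
    exact ⟨hdense i _ _ (fun q hq => (hrat i q hq).1) t ht0,
      hdense i _ _ (fun q hq => (hrat i q hq).2) t ht0⟩

/-- The half-spaces whose trace on `C` and on the unit sphere of `N` lies in a member of `𝒰`. -/
def smallSlices (F : Submodule ℝ (StrongDual ℝ X)) (N : Seminorm ℝ X) (𝒰 : Set (Set X))
    (C : Set X) : Set (StrongDual ℝ X × ℝ) :=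
  {q | (q.1 ∈ F ∧ (∀ x, q.1 x ≤ N x) ∧ -2 ≤ q.2) ∧
    ∃ U ∈ 𝒰, ∀ x ∈ C, N x = 1 → q.2 < q.1 x → x ∈ U}

/-- The sets obtained from the unit ball of `N` by repeatedly removing all small slices. -/
def derivedBall (F : Submodule ℝ (StrongDual ℝ X)) (N : Seminorm ℝ X) (𝒰 : Set (Set X)) :
    ℕ → Set X
  | 0 => {x | N x ≤ 1}
  | k + 1 => {x | x ∈ derivedBall F N 𝒰 k ∧
      ∀ q ∈ smallSlices F N 𝒰 (derivedBall F N 𝒰 k), q.1 x ≤ q.2}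

variable {𝒰 : Set (Set X)}

theorem isSliceFamily_smallSlices (C : Set X) : IsSliceFamily F N (smallSlices F N 𝒰 C) :=
  fun _ hq => hq.1

theorem derivedBall_antitone : Antitone (derivedBall F N 𝒰) :=
  antitone_nat_of_succ_le fun _ _ hx => hx.1

/-- Any `f ∈ F` can be scaled to be dominated by `N`. Raising the level to at least `-2` loses
nothing at `z`, where the scaled functional is at least `-1`. -/
theorem notMem_derivedBall_succ (hN : IsEquivalentNorm N) {z : X} (hz : N z = 1) {k : ℕ}
    {f : StrongDual ℝ X} (hf : f ∈ F) {a : ℝ} (ha : a < f z) {U : Set X} (hU : U ∈ 𝒰)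
    (hsmall : ∀ x ∈ derivedBall F N 𝒰 k, N x = 1 → a < f x → x ∈ U) :
    z ∉ derivedBall F N 𝒰 (k + 1) := by
  rintro ⟨-, h⟩
  obtain ⟨c, hc, hcN⟩ := hN.exists_smul_le f
  have hlt : max (c * a) (-2) < c * f z := by
    refine max_lt (mul_lt_mul_of_pos_left ha hc) ?_
    have := neg_abs_le (c * f z)
    linarith [hcN z]
  refine (h (c • f, max (c * a) (-2)) ⟨⟨F.smul_mem _ hf, fun x => (le_abs_self _).trans (hcN x),
    le_max_right _ _⟩, U, hU, fun x hx hx1 hlt' => hsmall x hx hx1 ?_⟩).not_gt hlt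
  exact lt_of_mul_lt_mul_left ((le_max_left _ _).trans_lt hlt') hc.le

/-- If the iterated removal of small slices exhausts the unit sphere for each member of a
separating sequence of covers, then there is a rotund norm. -/
theorem admitsLscRotundNorm_of_derivedBall (hN : IsEquivalentNorm N) (hlsc : IsSigmaLsc F N)
    {𝒰 : ℕ → Set (Set X)}
    (hsep : ∀ x y : X, N x = 1 → N y = 1 → x ≠ y → ∃ n, ∀ U ∈ 𝒰 n, x ∈ U → y ∉ U)
    (hder : ∀ n z, N z = 1 → ∃ k, z ∉ derivedBall F N (𝒰 n) k) : AdmitsLscRotundNorm F := by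
  refine admitsLscRotundNorm_of_excess (ι := ℕ × ℕ) hN hlsc
    (fun i => isSliceFamily_smallSlices (𝒰 := 𝒰 i.1) (derivedBall F N (𝒰 i.1) i.2))
    fun x y hx hy hz hex => ?_
  by_contra hxy
  obtain ⟨n, hn⟩ := hsep x y hx hy hxy
  set D := derivedBall F N (𝒰 n) with hD
  set z := (1 / 2 : ℝ) • (x + y) with hzdef
  -- Stage `k` is the last one that the midpoint survives.
  obtain ⟨k, hk, hk'⟩ : ∃ k, z ∈ D k ∧ z ∉ D (k + 1) := by
    by_contra! hcon
    obtain ⟨k, hk⟩ := hder n z hz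
    exact hk (Nat.rec (show N z ≤ 1 from hz.le) hcon k)
  -- Before stage `k` the midpoint lies in no removed half-space, so its excess is zero; equality of
  -- excesses keeps `x` and `y` in as well.
  have hmem : ∀ j ≤ k, x ∈ D j ∧ y ∈ D j := by
    intro j
    induction j with
    | zero => exact fun _ => ⟨hx.le, hy.le⟩
    | succ j ih =>
      intro hj
      have hfam := isSliceFamily_smallSlices (F := F) (N := N) (𝒰 := 𝒰 n) (D j)
      have hz0 : excess (smallSlices F N (𝒰 n) (D j)) z ≤ 0 :=
        excess_le le_rfl fun q hq => sub_nonpos.2 ((derivedBall_antitone hj hk).2 q hq)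
      obtain ⟨e1, e2⟩ := hex (n, j)
      refine ⟨⟨(ih (by omega)).1, fun q hq => ?_⟩, ⟨(ih (by omega)).2, fun q hq => ?_⟩⟩
      · exact sub_nonpos.1 ((hfam.le_excess hq x).trans (e2.trans_le hz0))
      · exact sub_nonpos.1 ((hfam.le_excess hq y).trans ((e1.symm.trans e2).trans_le hz0))
  have hzq : ∃ q ∈ smallSlices F N (𝒰 n) (D k), q.2 < q.1 z := by
    by_contra! hcon
    exact hk' ⟨hk, hcon⟩
  obtain ⟨q, hq, hqx, hqy⟩ := (isSliceFamily_smallSlices (D k)).exists_common_slice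
    (hex (n, k)).1 (hex (n, k)).2 hzq
  obtain ⟨-, U, hU, hUs⟩ := hq
  exact hn U hU (hUs x (hmem k le_rfl).1 hx hqx) (hUs y (hmem k le_rfl).2 hy hqy)

/-- The members of the covers are themselves slices of the sphere, so one derivation already removes
the whole sphere. -/
theorem AdmitsLscGdeltaSliceNorm.admitsLscRotundNorm (h : AdmitsLscGdeltaSliceNorm F) :
    AdmitsLscRotundNorm F := by
  obtain ⟨N, hN, hlsc, G, ⟨-, hcov, hsep⟩, hG⟩ := h
  refine admitsLscRotundNorm_of_derivedBall (𝒰 := fun n => {V | ∃ U ∈ G n, V = Subtype.val '' U})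
    hN hlsc (fun x y hx hy hxy => ?_) fun n z hz => ⟨1, ?_⟩
  · obtain ⟨n, hn⟩ := hsep ⟨x, hx⟩ ⟨y, hy⟩ (fun h => hxy (congrArg Subtype.val h))
    refine ⟨n, ?_⟩
    rintro _ ⟨U, hU, rfl⟩ ⟨x', hx', rfl⟩ ⟨y', hy', rfl⟩
    exact hn ⟨U, ⟨hU, hx'⟩, hy'⟩
  · obtain ⟨U, hU, hzU⟩ : (⟨z, hz⟩ : unitSphere N) ∈ ⋃₀ G n := by rw [hcov]; trivial
    obtain ⟨_, ⟨f, hf, -, a, rfl⟩, rfl⟩ := hG n U hU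
    exact notMem_derivedBall_succ hN hz hf hzU ⟨_, hU, rfl⟩
      fun x _ hx hax => ⟨⟨x, hx⟩, hax, rfl⟩

theorem level_pos (n : ℕ) : (0 : ℝ) < 1 - 1 / (n + 2) := by
  have : (0 : ℝ) ≤ n := n.cast_nonneg
  rw [sub_pos, div_lt_one (by positivity)]
  linarith

theorem level_lt_one (n : ℕ) : 1 - 1 / ((n : ℝ) + 2) < 1 := sub_lt_self _ (by positivity)

/-- Points of the unit sphere of a rotund norm that share thin slices of every width coincide. -/
theorem IsRotund.eq_of_common_slices (hN : IsRotund N) {x y : X} (hx : N x = 1) (hy : N y = 1)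
    (h : ∀ n : ℕ, ∃ f : StrongDual ℝ X, (∀ w, |f w| ≤ N w) ∧ 1 - 1 / ((n : ℝ) + 2) < f x ∧
      1 - 1 / ((n : ℝ) + 2) < f y) : x = y := by
  refine hN x y (hx.trans hy.symm) (hx.trans (le_antisymm ?_ ?_))
  · have hlim : Tendsto (fun n : ℕ => 1 - 1 / ((n : ℝ) + 2)) atTop (𝓝 (1 - 0)) :=
      tendsto_const_nhds.sub (tendsto_const_nhds.div_atTop
        (tendsto_natCast_atTop_atTop.atTop_add tendsto_const_nhds))
    rw [sub_zero] at hlim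
    refine le_of_tendsto' hlim fun n => ?_
    obtain ⟨f, hf, h1, h2⟩ := h n
    have h3 := (le_abs_self _).trans (hf ((1 / 2 : ℝ) • (x + y)))
    simp only [map_smul, map_add, smul_eq_mul] at h3 ⊢
    linarith
  · have := midpoint_le N.convexOn x y
    linarith

theorem AdmitsLscRotundNorm.admitsLscGdeltaSliceNorm (h : AdmitsLscRotundNorm F) :
    AdmitsLscGdeltaSliceNorm F := by
  obtain ⟨N, hN, hlsc, hrot⟩ := h
  refine ⟨N, hN, hlsc, fun n => {U | ∃ f ∈ F, (∀ w, |f w| ≤ N w) ∧ f ≠ 0 ∧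
    U = Subtype.val ⁻¹' {x | 1 - 1 / ((n : ℝ) + 2) < f x}}, ⟨?_, fun n => ?_, ?_⟩, ?_⟩
  · rintro n _ ⟨f, hf, -, -, rfl⟩
    exact @IsOpen.preimage _ _ (_) (sigma (F : Set (StrongDual ℝ X))) _ continuous_induced_dom _
      (isOpen_lt (β := SigmaSpace F) continuous_const (continuous_sigma_of_mem hf))
  · refine eq_univ_of_forall fun x => ?_
    obtain ⟨f, hf, hfN, hfx⟩ := exists_slice hlsc (level_pos n) (x := x)
      (by rw [show N x = 1 from x.2]; exact level_lt_one n)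
    refine ⟨_, ⟨f, hf, hfN, ?_, rfl⟩, hfx⟩
    -- The shift by 2 keeps the level positive even for `n = 0`, which rules out the zero
    -- functional.
    rintro rfl
    exact (level_pos n).not_gt hfx
  · intro x y hxy
    by_contra! hcon
    refine hxy (Subtype.ext (hrot.eq_of_common_slices x.2 y.2 fun n => ?_))
    obtain ⟨_, ⟨⟨f, hf, hfN, -, rfl⟩, hx⟩, hy⟩ := hcon n
    exact ⟨f, hfN, hx, hy⟩
  · rintro n _ ⟨f, hf, -, h0, rfl⟩
    exact ⟨_, ⟨f, hf, h0, _, rfl⟩, rfl⟩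

end Slices

/-! ### Extreme points of compact convex sets. -/

section ExtremePoints

variable {E : Type*} [AddCommGroup E] [Module ℝ E] [TopologicalSpace E] [IsTopologicalAddGroup E]
  [ContinuousSMul ℝ E]

theorem isCompact_convexJoin {s t : Set E} (hs : IsCompact s) (ht : IsCompact t) :
    IsCompact (convexJoin ℝ s t) := by
  have h : convexJoin ℝ s t =
      (fun q : (E × E) × ℝ => AffineMap.lineMap q.1.1 q.1.2 q.2) '' ((s ×ˢ t) ×ˢ Icc 0 1) := by
    ext x
    simp only [mem_convexJoin, segment_eq_image_lineMap, mem_image, Prod.exists, mem_prod]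
    constructor
    · rintro ⟨a, ha, b, hb, r, hr, rfl⟩
      exact ⟨a, b, r, ⟨⟨ha, hb⟩, hr⟩, rfl⟩
    · rintro ⟨a, b, r, ⟨⟨ha, hb⟩, hr⟩, rfl⟩
      exact ⟨a, ha, b, hb, r, hr, rfl⟩
  rw [h]
  refine ((hs.prod ht).prod isCompact_Icc).image ?_
  simp only [AffineMap.lineMap_apply_module]
  fun_prop

variable [LocallyConvexSpace ℝ E] [T2Space E]

/-- Choquet's lemma: the slices of a compact convex set that contain an extreme point form a
neighbourhood base of this point. -/
theorem exists_slice_subset_of_mem_extremePoints {C : Set E} (hC : IsCompact C)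
    (hconv : Convex ℝ C) {e : E} (he : e ∈ C.extremePoints ℝ) {U : Set E} (hU : IsOpen U)
    (heU : e ∈ U) : ∃ (f : StrongDual ℝ E) (u : ℝ), u < f e ∧ ∀ x ∈ C, u ≤ f x → x ∈ U := by
  -- Compactness reduces the claim to single points, handled by closed half-spaces missing `e`.
  -- Finitely many pieces are merged by convex joins, which miss `e` because it is extreme.
  obtain ⟨K, hK, hKconv, -, heK, hsub⟩ : ∃ K : Set E, IsCompact K ∧ Convex ℝ K ∧ K ⊆ C ∧ e ∉ K ∧
      C \ U ⊆ K := by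
    refine (hC.diff hU).induction_on (p := fun s => ∃ K : Set E, IsCompact K ∧ Convex ℝ K ∧
      K ⊆ C ∧ e ∉ K ∧ s ⊆ K) ⟨∅, isCompact_empty, convex_empty, empty_subset _, notMem_empty _,
        subset_rfl⟩ ?_ ?_ ?_
    · rintro s t hst ⟨K, h1, h2, h3, h4, h5⟩
      exact ⟨K, h1, h2, h3, h4, hst.trans h5⟩
    · rintro s t ⟨K, h1, h2, h3, h4, h5⟩ ⟨L, k1, k2, k3, k4, k5⟩
      rcases K.eq_empty_or_nonempty with rfl | hK
      · exact ⟨L, k1, k2, k3, k4, union_subset (h5.trans (empty_subset _)) k5⟩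
      rcases L.eq_empty_or_nonempty with rfl | hL
      · exact ⟨K, h1, h2, h3, h4, union_subset h5 (k5.trans (empty_subset _))⟩
      refine ⟨convexJoin ℝ K L, isCompact_convexJoin h1 k1, h2.convexJoin k2, ?_, ?_,
        union_subset (h5.trans (subset_convexJoin_left hL))
          (k5.trans (subset_convexJoin_right hK))⟩
      · intro x hx
        obtain ⟨a, ha, b, hb, hab⟩ := mem_convexJoin.1 hx
        exact hconv.segment_subset (h3 ha) (k3 hb) hab
      · intro hx
        obtain ⟨a, ha, b, hb, hab⟩ := mem_convexJoin.1 hx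
        rcases (mem_extremePoints_iff_forall_segment.1 he).2 a (h3 ha) b (k3 hb) hab with rfl | rfl
        exacts [h4 ha, k4 hb]
    · rintro x ⟨hxC, hxU⟩
      have hne : e ≠ x := fun h => hxU (h ▸ heU)
      obtain ⟨f, hf⟩ := geometric_hahn_banach_point_point hne
      obtain ⟨v, hv1, hv2⟩ := exists_between hf
      refine ⟨C ∩ {y | v ≤ f y}, ?_, C ∩ {y | v ≤ f y},
        hC.inter_right (isClosed_le continuous_const f.continuous),
        hconv.inter (convex_halfSpace_ge f.toLinearMap.isLinear v), inter_subset_left,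
        fun h => h.2.not_gt hv1, subset_rfl⟩
      rw [mem_nhdsWithin]
      exact ⟨{y | v < f y}, isOpen_lt continuous_const f.continuous, hv2,
        fun y hy => ⟨hy.2.1, (show v < f y from hy.1).le⟩⟩
  obtain ⟨f, u, hu, hfe⟩ := geometric_hahn_banach_closed_point hKconv hK.isClosed heK
  refine ⟨f, u, hfe, fun x hx hxu => ?_⟩
  by_contra hxU
  exact (hu x (hsub ⟨hx, hxU⟩)).not_ge hxu

/-- If a point of a compact convex set almost maximizes a sequence of functionals bounded by `1`,
then some extreme point maximizes it asymptotically. -/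
theorem exists_mem_extremePoints_tendsto {C : Set E} (hC : IsCompact C)
    {ℓ : ℕ → StrongDual ℝ E} (hℓ : ∀ k, ∀ x ∈ C, ℓ k x ≤ 1) {z : E} (hz : z ∈ C)
    (hℓz : ∀ k, 1 - (1 / 2 : ℝ) ^ k ≤ ℓ k z) :
    ∃ e ∈ C.extremePoints ℝ, Tendsto (fun k => ℓ k e) atTop (𝓝 1) := by
  -- The total defect is lower semicontinuous, affine on `C` and finite at `z`, so its minimizers
  -- form a compact extreme subset of `C`. A finite sum forces the defects to tend to zero.
  set g : E → ENNReal := fun x => ∑' k, ENNReal.ofReal (1 - ℓ k x) with hg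
  have hlsc : LowerSemicontinuous g := lowerSemicontinuous_tsum fun k =>
    (ENNReal.continuous_ofReal.comp
      (continuous_const.sub (ℓ k).continuous)).lowerSemicontinuous
  obtain ⟨m, hm, hmin⟩ := LowerSemicontinuousOn.exists_isMinOn ⟨z, hz⟩ hC
    (hlsc.lowerSemicontinuousOn C)
  have hfin : g m ≠ ⊤ := by
    refine ne_top_of_le_ne_top ?_ (hmin hz)
    have h1 : Summable fun k : ℕ => (1 / 2 : ℝ) ^ k := summable_geometric_two
    refine ne_top_of_le_ne_top h1.tsum_ofReal_ne_top (ENNReal.tsum_le_tsum fun k => ?_)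
    exact ENNReal.ofReal_le_ofReal (by linarith [hℓz k])
  set M : Set E := C ∩ {x | g x ≤ g m} with hM
  have hMc : IsCompact M := hC.inter_right (hlsc.isClosed_preimage (g m))
  have hMext : IsExtreme ℝ C M := by
    refine ⟨inter_subset_left, fun x hx y hy w hw hseg => ⟨hx, ?_⟩⟩
    obtain ⟨a, b, ha, hb, hab, rfl⟩ := hseg
    have hsplit : g (a • x + b • y) = ENNReal.ofReal a * g x + ENNReal.ofReal b * g y := by
      simp only [hg]
      rw [← ENNReal.tsum_mul_left, ← ENNReal.tsum_mul_left, ← ENNReal.tsum_add]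
      refine tsum_congr fun k => ?_
      rw [← ENNReal.ofReal_mul ha.le, ← ENNReal.ofReal_mul hb.le, ← ENNReal.ofReal_add
        (mul_nonneg ha.le (sub_nonneg.2 (hℓ k x hx)))
        (mul_nonneg hb.le (sub_nonneg.2 (hℓ k y hy)))]
      congr 1
      simp only [map_add, map_smul, smul_eq_mul]
      linear_combination (-1 : ℝ) * hab
    have hone : ENNReal.ofReal a + ENNReal.ofReal b = 1 := by
      rw [← ENNReal.ofReal_add ha.le hb.le, hab, ENNReal.ofReal_one]
    have hsum : ENNReal.ofReal a * g x + ENNReal.ofReal b * g m ≤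
        ENNReal.ofReal a * g m + ENNReal.ofReal b * g m := by
      rw [← add_mul, hone, one_mul]
      refine le_trans ?_ hw.2
      rw [hsplit]
      gcongr
      exact hmin hy
    have hle : ENNReal.ofReal a * g x ≤ ENNReal.ofReal a * g m :=
      (ENNReal.add_le_add_iff_right (ENNReal.mul_ne_top ENNReal.ofReal_ne_top hfin)).1 hsum
    exact (ENNReal.mul_le_mul_iff_right (ENNReal.ofReal_pos.2 ha).ne'
      ENNReal.ofReal_ne_top).1 hle
  obtain ⟨e, he⟩ := hMc.extremePoints_nonempty ⟨m, hm, le_refl (g m)⟩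
  have heM : e ∈ M := he.1
  refine ⟨e, hMext.extremePoints_subset_extremePoints he, ?_⟩
  have h0 := ENNReal.tendsto_atTop_zero_of_tsum_ne_top (ne_top_of_le_ne_top hfin heM.2)
  have h1 := (ENNReal.tendsto_toReal ENNReal.zero_ne_top).comp h0
  have h2 : Tendsto (fun k => 1 - ℓ k e) atTop (𝓝 0) := by
    refine h1.congr fun k => ?_
    exact ENNReal.toReal_ofReal (sub_nonneg.2 (hℓ k e heM.1))
  simpa using tendsto_const_nhds (x := (1 : ℝ)).sub h2

end ExtremePoints

/-! ### Dual norms and the weak* topology; the equivalence of (1) and (3). -/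

section Dual

variable {Y : Type*} [NormedAddCommGroup Y] [NormedSpace ℝ Y]
  {N : Seminorm ℝ (StrongDual ℝ Y)}

theorem mem_predual_iff {g : StrongDual ℝ (StrongDual ℝ Y)} :
    g ∈ predual Y ↔ ∃ y, ∀ f, g f = f y := by
  constructor
  · rintro ⟨y, rfl⟩
    exact ⟨y, fun f => rfl⟩
  · rintro ⟨y, hy⟩
    exact ⟨y, ContinuousLinearMap.ext fun f => (hy f).symm⟩

theorem continuous_weakDual_of_mem_predual {g : StrongDual ℝ (StrongDual ℝ Y)}
    (hg : g ∈ predual Y) : Continuous fun f : WeakDual ℝ Y => g (WeakDual.toStrongDual f) := by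
  obtain ⟨y, hy⟩ := mem_predual_iff.1 hg
  simp only [hy]
  exact WeakDual.eval_continuous y

theorem exists_predual_eq (g : StrongDual ℝ (WeakDual ℝ Y)) :
    ∃ h ∈ predual Y, ∀ f : WeakDual ℝ Y, g f = h (WeakDual.toStrongDual f) := by
  obtain ⟨y, rfl⟩ := LinearMap.dualEmbedding_surjective (topDualPairing ℝ Y) g
  exact ⟨NormedSpace.inclusionInDoubleDual ℝ Y y, ⟨y, rfl⟩, fun f => rfl⟩

theorem locallyConvexSpace_weakDual : LocallyConvexSpace ℝ (WeakDual ℝ Y) :=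
  WeakBilin.locallyConvexSpace (B := topDualPairing ℝ Y)

theorem IsEquivalentDualNorm.isEquivalentNorm (hN : IsEquivalentDualNorm N) :
    IsEquivalentNorm N := by
  obtain ⟨p, ⟨c, C, hc, hC, hp⟩, hlub⟩ := hN
  refine ⟨C⁻¹, c⁻¹, inv_pos.2 hC, inv_pos.2 hc, fun f => ⟨?_, ?_⟩⟩
  · rw [← div_eq_inv_mul, div_le_iff₀ hC]
    refine f.opNorm_le_of_unit_norm (mul_nonneg (apply_nonneg N f) hC.le) fun y hy => ?_
    have hmem := (hlub f).1 ⟨C⁻¹ • y, ?_, rfl⟩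
    · rw [map_smul, smul_eq_mul, abs_mul, abs_of_pos (inv_pos.2 hC), ← div_eq_inv_mul,
        div_le_iff₀ hC] at hmem
      exact hmem
    · rw [map_smul_eq_mul, Real.norm_of_nonneg (inv_pos.2 hC).le, ← div_eq_inv_mul,
        div_le_one hC]
      simpa [hy] using (hp y).2
  · refine (hlub f).2 ?_
    rintro _ ⟨y, hy, rfl⟩
    refine (f.le_opNorm y).trans ?_
    rw [mul_comm]
    gcongr
    rw [← one_div, le_div_iff₀ hc, mul_comm]
    exact ((hp y).1).trans hy

theorem IsEquivalentDualNorm.isSigmaLsc (hN : IsEquivalentDualNorm N) :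
    IsSigmaLsc (predual Y) N := by
  obtain ⟨p, -, hlub⟩ := hN
  rw [isSigmaLsc_iff, sigmaLowerSemicontinuous_iff]
  intro r
  have hset : {f : SigmaSpace (predual Y) | N f ≤ r} = ⋂ y : {y : Y // p y ≤ 1},
      {f : SigmaSpace (predual Y) | |NormedSpace.inclusionInDoubleDual ℝ Y y f| ≤ r} := by
    refine Set.ext fun (f : StrongDual ℝ Y) => ?_
    change N f ≤ r ↔ f ∈ ⋂ y : {y : Y // p y ≤ 1}, {f : StrongDual ℝ Y | |f y| ≤ r}
    rw [isLUB_le_iff (hlub f), mem_iInter]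
    constructor
    · exact fun h y => h ⟨y, y.2, rfl⟩
    · rintro h _ ⟨y, hy, rfl⟩
      exact h ⟨y, hy⟩
  rw [hset]
  exact isClosed_iInter fun y => isClosed_le
    (continuous_sigma_of_mem (F := predual Y) ⟨(y : Y), rfl⟩).abs continuous_const

theorem isClosed_weakDual_ball (hN : IsEquivalentDualNorm N) :
    IsClosed {f : WeakDual ℝ Y | N (WeakDual.toStrongDual f) ≤ 1} := by
  obtain ⟨p, -, hlub⟩ := hN
  have hset : {f : WeakDual ℝ Y | N (WeakDual.toStrongDual f) ≤ 1} =
      ⋂ y : {y : Y // p y ≤ 1}, {f : WeakDual ℝ Y | |f y| ≤ 1} := by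
    refine Set.ext fun f => ?_
    rw [mem_ofPred_eq, isLUB_le_iff (hlub _), mem_iInter]
    constructor
    · exact fun h y => h ⟨y, y.2, rfl⟩
    · rintro h _ ⟨y, hy, rfl⟩
      exact h ⟨y, hy⟩
  rw [hset]
  exact isClosed_iInter fun y => isClosed_le (WeakDual.eval_continuous _).abs continuous_const

theorem isCompact_weakDual_ball (hN : IsEquivalentDualNorm N) :
    IsCompact {f : WeakDual ℝ Y | N (WeakDual.toStrongDual f) ≤ 1} := by
  refine WeakDual.isCompact_of_bounded_of_closed ?_ (isClosed_weakDual_ball hN)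
  obtain ⟨c, C, hc, -, h⟩ := hN.isEquivalentNorm
  refine (WeakDual.isBounded_closedBall (0 : StrongDual ℝ Y) (1 / c)).subset fun f hf => ?_
  rw [mem_preimage, mem_closedBall_zero_iff, le_div_iff₀ hc, mul_comm]
  exact (h _).1.trans hf

/-- The weak* copy of the iterated derived sets of the unit ball. -/
def weakDerivedBall (N : Seminorm ℝ (StrongDual ℝ Y)) (𝒰 : Set (Set (StrongDual ℝ Y))) (k : ℕ) :
    Set (WeakDual ℝ Y) :=
  WeakDual.toStrongDual ⁻¹' derivedBall (predual Y) N 𝒰 k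

variable {𝒰 : Set (Set (StrongDual ℝ Y))}

theorem weakDerivedBall_succ (k : ℕ) : weakDerivedBall N 𝒰 (k + 1) =
    weakDerivedBall N 𝒰 k ∩ ⋂ q : smallSlices (predual Y) N 𝒰 (derivedBall (predual Y) N 𝒰 k),
      {f : WeakDual ℝ Y | q.1.1 (WeakDual.toStrongDual f) ≤ q.1.2} := by
  refine Set.ext fun f => ?_
  rw [mem_inter_iff, mem_iInter]
  exact ⟨fun h => ⟨h.1, fun q => h.2 q.1 q.2⟩, fun h => ⟨h.1, fun q hq => h.2 ⟨q, hq⟩⟩⟩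

theorem isClosed_weakDerivedBall (hN : IsEquivalentDualNorm N) (k : ℕ) :
    IsClosed (weakDerivedBall N 𝒰 k) := by
  induction k with
  | zero => exact isClosed_weakDual_ball hN
  | succ k ih =>
    rw [weakDerivedBall_succ]
    exact ih.inter (isClosed_iInter fun q => isClosed_le
      (continuous_weakDual_of_mem_predual q.2.1.1) continuous_const)

theorem convex_weakDerivedBall (N : Seminorm ℝ (StrongDual ℝ Y))
    (𝒰 : Set (Set (StrongDual ℝ Y))) (k : ℕ) : Convex ℝ (weakDerivedBall N 𝒰 k) := by
  induction k with
  | zero =>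
    have h : Convex ℝ {f | N f ≤ 1} := by simpa using N.convexOn.convex_le 1
    exact h.linear_preimage (WeakDual.toStrongDual : WeakDual ℝ Y ≃ₗ[ℝ] _).toLinearMap
  | succ k ih =>
    rw [weakDerivedBall_succ]
    exact ih.inter (convex_iInter fun q => convex_halfSpace_le
      (q.1.1.toLinearMap ∘ₗ (WeakDual.toStrongDual : WeakDual ℝ Y ≃ₗ[ℝ] _).toLinearMap).isLinear _)

theorem weakDerivedBall_antitone : Antitone (weakDerivedBall N 𝒰) :=
  fun _ _ h => preimage_mono (derivedBall_antitone h)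

theorem isCompact_weakDerivedBall (hN : IsEquivalentDualNorm N) (k : ℕ) :
    IsCompact (weakDerivedBall N 𝒰 k) :=
  (isCompact_weakDual_ball hN).of_isClosed_subset (isClosed_weakDerivedBall hN k)
    (weakDerivedBall_antitone (Nat.zero_le k))

/-- Points of the unit sphere of a dual norm almost attain their norm on the predual ball. -/
theorem IsEquivalentDualNorm.exists_predual (hN : IsEquivalentDualNorm N) {z : StrongDual ℝ Y}
    {t : ℝ} (ht : t < N z) : ∃ y : Y, (∀ f, f y ≤ N f) ∧ t ≤ z y := by
  obtain ⟨p, -, hlub⟩ := hN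
  obtain ⟨_, ⟨y, hy, rfl⟩, hlt, -⟩ := (hlub z).exists_between ht
  rcases le_total 0 (z y) with h0 | h0
  · exact ⟨y, fun f => (le_abs_self _).trans ((hlub f).1 ⟨y, hy, rfl⟩),
      (abs_of_nonneg h0 ▸ hlt).le⟩
  · refine ⟨-y, fun f => (le_abs_self _).trans ((hlub f).1 ⟨-y, by rwa [map_neg_eq_map], rfl⟩),
      ?_⟩
    rw [map_neg, ← abs_of_nonpos h0]
    exact hlt.le

/-- The iterated derived sets of a dual ball exhaust the unit sphere if the removed slices are
those subordinate to a family of sets that is relatively weak* open and covers the sphere. -/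
theorem exists_notMem_derivedBall (hN : IsEquivalentDualNorm N)
    (hopen : ∀ z, N z = 1 → ∃ U ∈ 𝒰, ∃ W : Set (WeakDual ℝ Y), IsOpen W ∧
      StrongDual.toWeakDual z ∈ W ∧ ∀ f ∈ W, N (WeakDual.toStrongDual f) = 1 →
        WeakDual.toStrongDual f ∈ U)
    {z : StrongDual ℝ Y} (hz : N z = 1) : ∃ k, z ∉ derivedBall (predual Y) N 𝒰 k := by
  by_contra! hcon
  have := locallyConvexSpace_weakDual (Y := Y)
  set C : Set (WeakDual ℝ Y) := ⋂ k, weakDerivedBall N 𝒰 k with hC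
  have hCc : IsCompact C := (isCompact_weakDerivedBall hN 0).of_isClosed_subset
    (isClosed_iInter fun k => isClosed_weakDerivedBall hN k) (iInter_subset _ 0)
  have hCconv : Convex ℝ C := convex_iInter fun k => convex_weakDerivedBall N 𝒰 k
  have hzC : StrongDual.toWeakDual z ∈ C := mem_iInter.2 hcon
  have hCB : ∀ f ∈ C, N (WeakDual.toStrongDual f) ≤ 1 := fun f hf => mem_iInter.1 hf 0
  choose y hyN hyz using fun k : ℕ => hN.exists_predual (z := z) (t := 1 - (1 / 2 : ℝ) ^ k)
    (by rw [hz]; exact sub_lt_self _ (by positivity))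
  let ℓ : ℕ → StrongDual ℝ (WeakDual ℝ Y) := fun k => WeakBilin.eval (topDualPairing ℝ Y) (y k)
  have hℓ : ∀ k f, ℓ k f = f (y k) := fun k f => rfl
  -- The functionals are dominated by `N` and tend to 1 at `e`, which puts `e` on the sphere.
  obtain ⟨e, he, hlim⟩ := exists_mem_extremePoints_tendsto hCc (ℓ := ℓ)
    (fun k f hf => (hyN k (WeakDual.toStrongDual f)).trans (hCB f hf)) hzC hyz
  have heN : N (WeakDual.toStrongDual e) = 1 :=
    le_antisymm (hCB e he.1) (le_of_tendsto' hlim fun k => hyN k (WeakDual.toStrongDual e))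
  obtain ⟨U, hU, W, hW, heW, hWU⟩ := hopen _ heN
  obtain ⟨g, u, hue, hsl⟩ := exists_slice_subset_of_mem_extremePoints hCc hCconv he hW heW
  -- The closed slices `{u ≤ g}` of the stages are compact and decrease to a slice of `C` inside
  -- `W`, so one of them already lies in `W`.
  obtain ⟨k, hk⟩ := exists_subset_nhds_of_isCompact'
    (V := fun k => weakDerivedBall N 𝒰 k ∩ {f | u ≤ g f})
    (directed_of_isDirected_le fun i j hij =>
      inter_subset_inter_left _ (weakDerivedBall_antitone hij))
    (fun k => (isCompact_weakDerivedBall hN k).inter_right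
      (isClosed_le continuous_const g.continuous))
    (fun k => (isClosed_weakDerivedBall hN k).inter (isClosed_le continuous_const g.continuous))
    (U := W) fun f hf => hW.mem_nhds (hsl f
      (mem_iInter.2 fun k => (mem_iInter.1 hf k).1) (mem_iInter.1 hf 0).2)
  obtain ⟨h, hh, hgh⟩ := exists_predual_eq g
  refine notMem_derivedBall_succ (k := k) hN.isEquivalentNorm heN hh (a := u) ?_ hU ?_
    (mem_iInter.1 he.1 (k + 1))
  · rw [← hgh]
    exact hue
  · intro x hx hx1 hux
    refine hWU (StrongDual.toWeakDual x) (hk ⟨hx, ?_⟩) hx1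
    change u ≤ g (StrongDual.toWeakDual x)
    rw [hgh]
    exact hux.le

theorem AdmitsDualGdeltaNorm.admitsLscRotundNorm (h : AdmitsDualGdeltaNorm Y) :
    AdmitsLscRotundNorm (predual Y) := by
  obtain ⟨N, hN, hG⟩ := h
  obtain ⟨G, hop, hcov, hsep⟩ := (hasGdeltaDiagonal_iff _).1 hG
  refine admitsLscRotundNorm_of_derivedBall
    (𝒰 := fun n => {V | ∃ U ∈ G n, V = (fun w => WeakDual.toStrongDual w.1) '' U})
    hN.isEquivalentNorm hN.isSigmaLsc (fun x y hx hy hxy => ?_) fun n z hz =>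
      exists_notMem_derivedBall hN (fun x hx => ?_) hz
  · obtain ⟨n, hn⟩ := hsep ⟨StrongDual.toWeakDual x, hx⟩ ⟨StrongDual.toWeakDual y, hy⟩
      (fun h => hxy (congrArg (fun w : WeakDual ℝ Y => WeakDual.toStrongDual w)
        (congrArg Subtype.val h)))
    refine ⟨n, ?_⟩
    rintro _ ⟨U, hU, rfl⟩ ⟨x', hx', rfl⟩ ⟨y', hy', rfl⟩
    exact hn ⟨U, ⟨hU, hx'⟩, hy'⟩
  · obtain ⟨U, hU, hxU⟩ : (⟨StrongDual.toWeakDual x, hx⟩ :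
        {f : WeakDual ℝ Y // WeakDual.toStrongDual f ∈ unitSphere N}) ∈ ⋃₀ G n := by
      rw [hcov]; trivial
    obtain ⟨W, hW, rfl⟩ := isOpen_induced_iff.1 (hop n U hU)
    exact ⟨_, ⟨_, hU, rfl⟩, W, hW, hxU, fun f hf hf1 => ⟨⟨f, hf1⟩, hf, rfl⟩⟩

/-- The norm on `Y` that is dual to a norm on `Y*`. -/
theorem exists_predual_seminorm (hN : IsEquivalentNorm N) :
    ∃ p : Seminorm ℝ Y, IsEquivalentNorm p ∧
      ∀ y, IsLUB {r : ℝ | ∃ f, N f ≤ 1 ∧ r = |f y|} (p y) := by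
  obtain ⟨c, C, hc, hC, h⟩ := hN
  have hbound : ∀ (f : StrongDual ℝ Y) (y : Y), N f ≤ 1 → |f y| ≤ c⁻¹ * ‖y‖ := fun f y hf => by
    refine (f.le_opNorm y).trans ?_
    gcongr
    rw [← one_div, le_div_iff₀ hc, mul_comm]
    exact (h f).1.trans hf
  have hbdd : ∀ y : Y, BddAbove (range fun f : {f // N f ≤ 1} => |(f : StrongDual ℝ Y) y|) :=
    fun y => ⟨c⁻¹ * ‖y‖, by rintro _ ⟨f, rfl⟩; exact hbound f y f.2⟩
  have : Nonempty {f // N f ≤ 1} := ⟨⟨0, by simp⟩⟩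
  let p : Seminorm ℝ Y := Seminorm.of (fun y => ⨆ f : {f // N f ≤ 1}, |(f : StrongDual ℝ Y) y|)
    (fun x y => ciSup_le fun f => by
      rw [map_add]
      exact (abs_add_le _ _).trans (add_le_add (le_ciSup (hbdd x) f) (le_ciSup (hbdd y) f)))
    (fun a x => by
      simp only [map_smul, smul_eq_mul, abs_mul, Real.norm_eq_abs]
      rw [Real.mul_iSup_of_nonneg (abs_nonneg a)])
  have hp : ∀ y, p y = ⨆ f : {f // N f ≤ 1}, |(f : StrongDual ℝ Y) y| := fun y => rfl
  refine ⟨p, ⟨C⁻¹, c⁻¹, inv_pos.2 hC, inv_pos.2 hc, fun y => ⟨?_, ?_⟩⟩, fun y => ⟨?_, ?_⟩⟩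
  · obtain ⟨g, hg1, hg⟩ := exists_dual_vector'' ℝ y
    have hN1 : N (C⁻¹ • g) ≤ 1 := by
      rw [map_smul_eq_mul, Real.norm_of_nonneg (inv_pos.2 hC).le, ← div_eq_inv_mul,
        div_le_one hC]
      nlinarith [(h g).2]
    refine le_trans (le_of_eq ?_) (le_ciSup (hbdd y) ⟨C⁻¹ • g, hN1⟩)
    have hgy : g y = ‖y‖ := by simpa using hg
    simp [hgy, abs_mul, abs_of_pos hC]
  · exact ciSup_le fun f => hbound f y f.2
  · rintro _ ⟨f, hf, rfl⟩
    exact le_ciSup (hbdd y) ⟨f, hf⟩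
  · exact fun b hb => ciSup_le fun f => hb ⟨f, f.2, rfl⟩

/-- A weak* lower semicontinuous equivalent norm is a dual norm. -/
theorem isEquivalentDualNorm_of_isSigmaLsc (hN : IsEquivalentNorm N)
    (hlsc : IsSigmaLsc (predual Y) N) : IsEquivalentDualNorm N := by
  obtain ⟨p, hp, hlub⟩ := exists_predual_seminorm hN
  refine ⟨p, hp, fun f => ⟨?_, fun b hb => ?_⟩⟩
  · rintro _ ⟨y, hy, rfl⟩
    refine le_of_forall_gt_imp_ge_of_dense fun t ht => ?_
    have ht0 : 0 < t := (apply_nonneg N f).trans_lt ht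
    have h1 := (hlub y).1 ⟨t⁻¹ • f, ?_, rfl⟩
    · rw [smul_apply, smul_eq_mul, abs_mul, abs_of_pos (inv_pos.2 ht0), ← div_eq_inv_mul,
        div_le_iff₀ ht0] at h1
      nlinarith
    · rw [map_smul_eq_mul, Real.norm_of_nonneg (inv_pos.2 ht0).le, ← div_eq_inv_mul,
        div_le_one ht0]
      exact ht.le
  · have hb0 : 0 ≤ b := hb ⟨0, by simp, by simp⟩
    by_contra! hlt
    obtain ⟨t, ht1, ht2⟩ := exists_between hlt
    -- Bipolar argument: the separating functional is evaluation at some `y` with `p y ≤ 1`, yet `f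
    -- y > b`.
    obtain ⟨g, hg, hgN, hgt⟩ := exists_slice hlsc (hb0.trans_lt ht1) ht2
    obtain ⟨y, hy⟩ := mem_predual_iff.1 hg
    rw [hy] at hgt
    have hpy : p y ≤ 1 := (hlub y).2 (by
      rintro _ ⟨f', hf', rfl⟩
      rw [← hy]
      exact (hgN f').trans hf')
    have := hb ⟨y, hpy, rfl⟩
    linarith [le_abs_self (f y)]

theorem AdmitsLscRotundNorm.admitsDualGdeltaNorm (h : AdmitsLscRotundNorm (predual Y)) :
    AdmitsDualGdeltaNorm Y := by
  obtain ⟨N, hN, hlsc, hrot⟩ := h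
  refine ⟨N, isEquivalentDualNorm_of_isSigmaLsc hN hlsc, (hasGdeltaDiagonal_iff _).2
    ⟨fun n => {U | ∃ g ∈ predual Y, (∀ w, |g w| ≤ N w) ∧
      U = {x | 1 - 1 / ((n : ℝ) + 2) < g (WeakDual.toStrongDual x.1)}}, ?_, fun n => ?_, ?_⟩⟩
  · rintro n _ ⟨g, hg, -, rfl⟩
    exact isOpen_lt continuous_const
      ((continuous_weakDual_of_mem_predual hg).comp continuous_subtype_val)
  · refine eq_univ_of_forall fun x => ?_
    obtain ⟨g, hg, hgN, hgx⟩ := exists_slice hlsc (level_pos n) (x := WeakDual.toStrongDual x.1)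
      (by rw [show N (WeakDual.toStrongDual x.1) = 1 from x.2]; exact level_lt_one n)
    exact ⟨_, ⟨g, hg, hgN, rfl⟩, hgx⟩
  · intro x y hxy
    by_contra! hcon
    refine hxy (Subtype.ext (WeakDual.toStrongDual.injective
      (hrot.eq_of_common_slices x.2 y.2 fun n => ?_)))
    obtain ⟨_, ⟨⟨g, -, hgN, rfl⟩, hx⟩, hy⟩ := hcon n
    exact ⟨g, hgN, hx, hy⟩

end Dual

end Renorming

theorem mainTheorem2 :
    (∀ (X : Type*) [NormedAddCommGroup X] [NormedSpace ℝ X]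
      (F : Submodule ℝ (StrongDual ℝ X)), Renorming.IsNorming F →
        (Renorming.AdmitsLscRotundNorm F ↔ Renorming.AdmitsLscGdeltaSliceNorm F)) ∧
    (∀ (Y : Type*) [NormedAddCommGroup Y] [NormedSpace ℝ Y],
      Renorming.AdmitsLscRotundNorm (Renorming.predual Y) ↔
        Renorming.AdmitsDualGdeltaNorm Y) := by
  exact ⟨fun _ _ _ _ _ => ⟨fun h => h.admitsLscGdeltaSliceNorm, fun h => h.admitsLscRotundNorm⟩,
    fun _ _ _ => ⟨fun h => h.admitsDualGdeltaNorm, fun h => h.admitsLscRotundNorm⟩⟩
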